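/- Let $H$ be a real separable Hilbert space with inner product $\langle\cdot,\cdot\rangle$, and let $X=\{X(h):h\in H\}$ be an isonormal Gaussian process on $H$, that is, a centered Gaussian family on a probability space $(\Omega,\mathcal F,\mathbb P)$ with $\mathbb E[X(h)X(h')]=\langle h,h'\rangle$ for all $h,h'\in H$. For $n\ge 1$ let $H^{\odot n}$ be the $n$-th symmetric Hilbert space tensor power of $H$, i.e. the closed subspace of the permutation-invariant elements of the Hilbert space tensor power $H^{\otimes n}$, and let $I_n^X$ be the multiple integral of order $n$ with respect to $X$: the continuous linear map from $H^{\odot n}$ to $L^2(\mathbb P)$ given, for any complete orthonormal system $(e_k)$ of $H$, by $$I_n^X(f)=\sum_{i_1,\dots,i_n}\langle f,e_{i_1}\otimes\cdots\otimes e_{i_n}\rangle_{H^{\otimes n}}\ \prod_{k}\mathrm{He}_{m_k(i)}\big(X(e_k)\big),\qquad m_k(i)=\#\{j: i_j=k\},$$ where $\mathrm{He}_m$ is the monic Hermite polynomial of degree $m$ (orthogonal for the law $N(0,1)$); it satisfies $\mathbb E[I_n^X(f)^2]=n!\,\|f\|_{H^{\otimes n}}^2$. Fix $n\ge 2$ and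 $f\in H^{\odot n}$ such that $\mathbb E[I_n^X(f)^2]=1$. Then the distribution of $I_n^X(f)$ is not normal (for any mean and variance), and $I_n^X(f)$ has a finite fourth moment with $\mathbb E[I_n^X(f)^4]\neq 3$. -/

import Mathlib

open MeasureTheory ProbabilityTheory
open scoped ENNReal TensorProduct

/-! ### The Hilbert space tensor powers of a real Hilbert space -/

section TensorPower

variable {H : Type*} [NormedAddCommGroup H] [InnerProductSpace ℝ H]

/-- The algebraic `n`-th tensor power of `H`. It is a type of its own because the norm that it
carries below comes from the inner product, and is not one of the cross norms in Mathlib. -/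
def AlgTensorPower (n : ℕ) (H : Type*) [NormedAddCommGroup H] [InnerProductSpace ℝ H] : Type _ :=
  ⨂[ℝ] _ : Fin n, H

noncomputable instance AlgTensorPower.instAddCommGroup (n : ℕ) :
    AddCommGroup (AlgTensorPower n H) :=
  inferInstanceAs (AddCommGroup (⨂[ℝ] _ : Fin n, H))

noncomputable instance AlgTensorPower.instModule (n : ℕ) : Module ℝ (AlgTensorPower n H) :=
  inferInstanceAs (Module ℝ (⨂[ℝ] _ : Fin n, H))

/-- The algebraic pure tensor `h₁ ⊗ ⋯ ⊗ hₙ`. -/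
noncomputable def algTprod {n : ℕ} (h : Fin n → H) : AlgTensorPower n H :=
  PiTensorProduct.tprod ℝ h

/-- The bilinear form on the algebraic tensor power with
`⟪g₁ ⊗ ⋯ ⊗ gₙ, h₁ ⊗ ⋯ ⊗ hₙ⟫ = ∏ i, ⟪gᵢ, hᵢ⟫`. -/
noncomputable def algTensorForm (n : ℕ) (H : Type*) [NormedAddCommGroup H]
    [InnerProductSpace ℝ H] : AlgTensorPower n H →ₗ[ℝ] AlgTensorPower n H →ₗ[ℝ] ℝ :=
  (PiTensorProduct.dualDistrib (R := ℝ) (M := fun _ : Fin n => H)) ∘ₗ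
    (PiTensorProduct.map (fun _ : Fin n => innerₗ H))

theorem algTensorForm_tprod {n : ℕ} (g h : Fin n → H) :
    algTensorForm n H (algTprod g) (algTprod h) = ∏ i, inner ℝ (g i) (h i) := by
  have h1 : PiTensorProduct.map (fun _ : Fin n => innerₗ H) (PiTensorProduct.tprod ℝ g) =
      PiTensorProduct.tprod ℝ fun i => innerₗ H (g i) := PiTensorProduct.map_tprod _ _
  have h2 := PiTensorProduct.dualDistrib_apply (R := ℝ) (M := fun _ : Fin n => H)
    (fun i => innerₗ H (g i)) h
  rw [← h1] at h2
  exact h2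

theorem algTensorPower_eq_sum {n : ℕ} (x : AlgTensorPower n H) :
    ∃ (m : ℕ) (c : Fin m → ℝ) (h : Fin m → Fin n → H), x = ∑ a, c a • algTprod (h a) := by
  have hx : x ∈ Submodule.span ℝ (Set.range (algTprod : (Fin n → H) → AlgTensorPower n H)) := by
    have : (⊤ : Submodule ℝ (AlgTensorPower n H)) =
        Submodule.span ℝ (Set.range (algTprod : (Fin n → H) → AlgTensorPower n H)) :=
      (PiTensorProduct.span_tprod_eq_top (R := ℝ) (s := fun _ : Fin n => H)).symm
    rw [← this]; trivial
  obtain ⟨m, c, g, hg⟩ := Submodule.mem_span_set'.1 hx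
  choose h hh using fun a => (g a).2
  exact ⟨m, c, h, by rw [← hg]; simp [hh]⟩

theorem algTensorForm_symm {n : ℕ} (x y : AlgTensorPower n H) :
    algTensorForm n H x y = algTensorForm n H y x := by
  obtain ⟨m, c, g, rfl⟩ := algTensorPower_eq_sum x
  obtain ⟨k, d, h, rfl⟩ := algTensorPower_eq_sum y
  simp only [map_sum, map_smul, LinearMap.sum_apply, LinearMap.smul_apply, algTensorForm_tprod,
    smul_eq_mul, Finset.mul_sum]
  rw [Finset.sum_comm]
  refine Finset.sum_congr rfl fun a _ => Finset.sum_congr rfl fun b _ => ?_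
  simp only [fun i => real_inner_comm (g a i) (h b i)]
  ring

theorem posSemidef_prod_inner {n m : ℕ} (h : Fin m → Fin n → H) :
    (Matrix.of fun a b => ∏ i, inner ℝ (h a i) (h b i)).PosSemidef := by
  classical
  have key : ∀ s : Finset (Fin n),
      (Matrix.of fun a b => ∏ i ∈ s, inner ℝ (h a i) (h b i)).PosSemidef := by
    intro s
    induction s using Finset.induction_on with
    | empty =>
      have heq : (Matrix.of fun a b => ∏ i ∈ ∅, inner ℝ (h a i) (h b i)) =
          Matrix.gram ℝ (fun _ : Fin m => (1 : ℝ)) := by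
        ext a b
        simp [Matrix.gram]
      rw [heq]
      exact Matrix.posSemidef_gram ℝ _
    | insert i s hi ih =>
      have heq : (Matrix.of fun a b => ∏ i ∈ insert i s, inner ℝ (h a i) (h b i)) =
          (Matrix.gram ℝ (fun a => h a i)).hadamard
            (Matrix.of fun a b => ∏ i ∈ s, inner ℝ (h a i) (h b i)) := by
        ext a b
        simp [Matrix.gram, Matrix.hadamard, Finset.prod_insert hi]
      rw [heq]
      exact (Matrix.posSemidef_gram ℝ (fun a => h a i)).hadamard ih
  exact key Finset.univ

theorem algTensorForm_nonneg {n : ℕ} (x : AlgTensorPower n H) : 0 ≤ algTensorForm n H x x := by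
  obtain ⟨m, c, h, rfl⟩ := algTensorPower_eq_sum x
  have := (posSemidef_prod_inner h).dotProduct_mulVec_nonneg c
  simp only [map_sum, map_smul, LinearMap.sum_apply, LinearMap.smul_apply, algTensorForm_tprod,
    smul_eq_mul]
  refine this.trans_eq ?_
  simp only [dotProduct, Matrix.mulVec, Matrix.of_apply, Pi.star_apply, star_trivial]
  refine Finset.sum_congr rfl fun a _ => ?_
  simp only [Finset.mul_sum]
  refine Finset.sum_congr rfl fun b _ => ?_
  simp only [fun i => real_inner_comm (h a i) (h b i)]
  ring

/-- The inner product on the algebraic tensor power. -/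
@[reducible]
noncomputable def algTensorCore (n : ℕ) (H : Type*) [NormedAddCommGroup H]
    [InnerProductSpace ℝ H] : PreInnerProductSpace.Core ℝ (AlgTensorPower n H) where
  inner x y := algTensorForm n H x y
  conj_inner_symm x y := by simpa using algTensorForm_symm y x
  re_inner_nonneg x := by simpa using algTensorForm_nonneg x
  add_left x y z := by simp
  smul_left x y r := by simp

noncomputable instance AlgTensorPower.instSeminormedAddCommGroup (n : ℕ) :
    SeminormedAddCommGroup (AlgTensorPower n H) :=
  letI := algTensorCore n H
  InnerProductSpace.Core.toSeminormedAddCommGroup (𝕜 := ℝ)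

noncomputable instance AlgTensorPower.instInnerProductSpace (n : ℕ) :
    InnerProductSpace ℝ (AlgTensorPower n H) :=
  InnerProductSpace.ofCore (algTensorCore n H)

/-- The `n`-th Hilbert space tensor power `H^{⊗ n}`: the completion of the algebraic one. -/
abbrev HilbertTensorPower (n : ℕ) (H : Type*) [NormedAddCommGroup H] [InnerProductSpace ℝ H] :
    Type _ :=
  UniformSpace.Completion (AlgTensorPower n H)

/-- The pure tensor `h₁ ⊗ ⋯ ⊗ hₙ` in `H^{⊗ n}`. -/
noncomputable def pureTensor {n : ℕ} (h : Fin n → H) : HilbertTensorPower n H :=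
  (algTprod h : AlgTensorPower n H)

theorem inner_pureTensor {n : ℕ} (g h : Fin n → H) :
    inner ℝ (pureTensor g) (pureTensor h) = ∏ i, inner ℝ (g i) (h i) := by
  rw [pureTensor, pureTensor, UniformSpace.Completion.inner_coe]
  exact algTensorForm_tprod g h

/-- The `n`-th symmetric tensor power `H^{⊙ n}`: the closed subspace of those elements of
`H^{⊗ n}` that are invariant under permutations of the `n` factors. As the pure tensors are
total, the invariance is tested on them. -/
noncomputable def symmTensorPower (n : ℕ) (H : Type*) [NormedAddCommGroup H]
    [InnerProductSpace ℝ H] : Submodule ℝ (HilbertTensorPower n H) where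
  carrier := {f | ∀ (σ : Equiv.Perm (Fin n)) (h : Fin n → H),
    inner ℝ f (pureTensor (h ∘ σ)) = inner ℝ f (pureTensor h)}
  add_mem' hf hg σ h := by rw [inner_add_left, inner_add_left, hf σ h, hg σ h]
  zero_mem' σ h := by rw [inner_zero_left, inner_zero_left]
  smul_mem' c f hf σ h := by rw [real_inner_smul_left, real_inner_smul_left, hf σ h]

end TensorPower

/-! ### Isonormal Gaussian processes and multiple integrals -/

section MultipleIntegral

variable {H Ω ι : Type*} [NormedAddCommGroup H] [InnerProductSpace ℝ H] [MeasurableSpace Ω]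

/-- `X` is an isonormal Gaussian process on `H`: a centered Gaussian family indexed by `H` with
covariance `E[X(h) X(h')] = ⟪h, h'⟫`. -/
structure IsIsonormal (X : H → Ω → ℝ) (P : Measure Ω) : Prop where
  isGaussianProcess : IsGaussianProcess X P
  centered : ∀ h, ∫ ω, X h ω ∂P = 0
  covariance : ∀ h h', ∫ ω, X h ω * X h' ω ∂P = inner ℝ h h'

open Classical in
/-- For an orthonormal basis `e` and indices `i₁, …, iₙ`, the product
`∏ₖ He_{m(k)}(X(e k))`, where `m(k)` is the number of times that `k` occurs among `i₁, …, iₙ`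
and `He_m` is the monic Hermite polynomial of degree `m`, orthogonal for the law `N(0, 1)`. -/
noncomputable def hermiteProd (X : H → Ω → ℝ) (e : HilbertBasis ι ℝ H) {n : ℕ} (i : Fin n → ι)
    (ω : Ω) : ℝ :=
  ∏ k ∈ Finset.univ.image i,
    Polynomial.aeval (X (e k) ω) (Polynomial.hermite (Finset.univ.filter fun j => i j = k).card)

theorem memLp_mul_of_forall {P : Measure Ω} {F G : Ω → ℝ}
    (hF : ∀ p : ℝ≥0∞, p ≠ ∞ → MemLp F p P) (hG : ∀ p : ℝ≥0∞, p ≠ ∞ → MemLp G p P)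
    (p : ℝ≥0∞) (hp : p ≠ ∞) : MemLp (fun ω => F ω * G ω) p P := by
  have hp2 : p * 2 ≠ ∞ := ENNReal.mul_ne_top hp (by simp)
  have : ENNReal.HolderTriple (p * 2) (p * 2) p := ⟨by
    rw [ENNReal.mul_inv (by simp) (by simp), ← mul_add, ENNReal.inv_two_add_inv_two, mul_one]⟩
  exact (hG _ hp2).mul (hF _ hp2)

theorem IsIsonormal.memLp_hermiteProd {P : Measure Ω} [IsProbabilityMeasure P] {X : H → Ω → ℝ}
    (hX : IsIsonormal X P) (e : HilbertBasis ι ℝ H) {n : ℕ} (i : Fin n → ι) (p : ℝ≥0∞)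
    (hp : p ≠ ∞) : MemLp (hermiteProd X e i) p P := by
  classical
  have hpow : ∀ (h : H) (m : ℕ) (p : ℝ≥0∞), p ≠ ∞ → MemLp (fun ω => X h ω ^ m) p P := by
    intro h m
    induction m with
    | zero => intro p _; simpa using memLp_const (1 : ℝ)
    | succ m ih =>
      intro p hp
      simp only [pow_succ]
      exact memLp_mul_of_forall ih
        (fun q hq => (hX.isGaussianProcess.hasGaussianLaw_eval h).memLp hq) p hp
  have hpoly : ∀ (h : H) (q : Polynomial ℤ) (p : ℝ≥0∞), p ≠ ∞ →
      MemLp (fun ω => Polynomial.aeval (X h ω) q) p P := by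
    intro h q p hp
    simp only [Polynomial.aeval_eq_sum_range, zsmul_eq_mul]
    exact memLp_finsetSum _ fun m _ => (hpow h m p hp).const_mul _
  have key : ∀ (s : Finset ι) (q : ι → Polynomial ℤ) (p : ℝ≥0∞), p ≠ ∞ →
      MemLp (fun ω => ∏ k ∈ s, Polynomial.aeval (X (e k) ω) (q k)) p P := by
    intro s q
    induction s using Finset.induction_on with
    | empty => intro p _; simpa using memLp_const (1 : ℝ)
    | insert k s hk ih =>
      intro p hp
      simp only [Finset.prod_insert hk]
      exact memLp_mul_of_forall (hpoly (e k) (q k)) ih p hp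
  convert! key (Finset.univ.image i)
    (fun k => Polynomial.hermite (Finset.univ.filter fun j => i j = k).card) p hp using 1

/-- The multiple integral `I_n^X(f)`, an element of `L²(P)`: the map that is linear and continuous
in `f` and sends the symmetrization of `e_{i₁} ⊗ ⋯ ⊗ e_{iₙ}` to the product of Hermite polynomials
`hermiteProd X e i`. For symmetric `f` the series converges unconditionally in `L²(P)`,
`E[I_n^X(f)²] = n! ‖f‖²`, and its sum is the same for every orthonormal basis `e`. -/
noncomputable def multipleIntegral {P : Measure Ω} [IsProbabilityMeasure P] {X : H → Ω → ℝ}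
    (hX : IsIsonormal X P) (e : HilbertBasis ι ℝ H) {n : ℕ} (f : symmTensorPower n H) :
    Lp ℝ 2 P :=
  ∑' i : Fin n → ι, (inner ℝ (f : HilbertTensorPower n H) (pureTensor fun j => e (i j)) : ℝ) •
    (hX.memLp_hermiteProd e i 2 (by simp)).toLp (hermiteProd X e i)

end MultipleIntegral

/-! On a fixed chaos of order at least two, a small excess of the fourth moment over its Gaussian
value forces every partial derivative to be small, which a normalized element cannot afford.

For a polynomial `p` of chaos order `n`, the square `p ^ 2` has components of order at most `2 * n`,
so the number operator `N` is at most `2 * n` on it, while the chain rule gives `E (p ^ 2 * N (p ^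
2)) = (4 * n / 3) * E (p ^ 4)`. Keeping the components of `p ^ 2` of order 0 and 2 in the spectral
gap, the latter tested against `X k ^ 2 - 1`, yields `6 * (n - 1) * E ((∂ₖ p) ^ 2) ^ 2 ≤ n * (E (p ^
4) - 3 * E (p ^ 2) ^ 2)` (`spectral_gap`, `map_pow_four_ge`).

A multiple integral `F` is an L² limit of such polynomials `p j`; by hypercontractivity
(`map_pow_four_le`) the fourth moments converge too. If `E F ^ 4 ≤ 3`, each `∂ₖ (p j)` tends to zero
in L². Since `n * E (p j * p l)` is a sum of `E (∂ₖ (p j) * ∂ₖ (p l))` over the finitely many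
variables of `p l`, `F` is orthogonal to every `p l`, hence to itself, against `E F ^ 2 = 1`.
Non-normality follows: `F` is centered with variance 1, so a normal law would have fourth moment 3.
-/

/-! ### Gaussian chaoses in the algebra of polynomials -/

section PolynomialChaos

open MvPolynomial

variable {ι : Type*}

/-- The creation operator `p ↦ Xₖ p - ∂ₖ p`, the Gaussian adjoint of `∂ₖ`. -/
noncomputable def creation (k : ι) : MvPolynomial ι ℝ →ₗ[ℝ] MvPolynomial ι ℝ :=
  LinearMap.mulLeft ℝ (X k) - (pderiv k).toLinearMap

theorem creation_apply (k : ι) (p : MvPolynomial ι ℝ) :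
    creation k p = X k * p - pderiv k p := rfl

theorem pderiv_creation_self (k : ι) (p : MvPolynomial ι ℝ) :
    pderiv k (creation k p) = p + creation k (pderiv k p) := by
  simp only [creation_apply, map_sub, pderiv_mul, pderiv_X_self]
  ring

/-- The commutator of two derivations is a derivation, so it suffices that it vanishes on the
variables. -/
theorem pderiv_comm (j k : ι) (p : MvPolynomial ι ℝ) :
    pderiv j (pderiv k p) = pderiv k (pderiv j p) := by
  classical
  have h :
      ⁅(pderiv j : Derivation ℝ (MvPolynomial ι ℝ) (MvPolynomial ι ℝ)),
        (pderiv k : Derivation ℝ (MvPolynomial ι ℝ) (MvPolynomial ι ℝ))⁆ = 0 := by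
    apply MvPolynomial.derivation_ext
    intro i
    rw [Derivation.commutator_apply]
    by_cases h1 : i = j <;> by_cases h2 : i = k <;>
      simp [pderiv_X, Pi.single_apply, apply_ite]
  have := congrArg (fun D => D p) h
  rw [← sub_eq_zero]
  simpa [Derivation.commutator_apply] using this

theorem pderiv_creation_of_ne {j k : ι} (h : j ≠ k) (p : MvPolynomial ι ℝ) :
    pderiv j (creation k p) = creation k (pderiv j p) := by
  simp only [creation_apply, map_sub, pderiv_mul, pderiv_X_of_ne h.symm, pderiv_comm j k]
  ring

theorem creation_comm (j k : ι) (p : MvPolynomial ι ℝ) :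
    creation j (creation k p) = creation k (creation j p) := by
  by_cases h : j = k
  · rw [h]
  · simp only [creation_apply, map_sub, pderiv_mul, pderiv_X_of_ne h, pderiv_comm j k,
      pderiv_X_of_ne (Ne.symm h)]
    ring

/-- The `n`-th Gaussian chaos of polynomials in the variables in `S`. -/
noncomputable def chaos (S : Finset ι) : ℕ → Submodule ℝ (MvPolynomial ι ℝ)
  | 0 => Submodule.span ℝ {1}
  | n + 1 => ⨆ k ∈ S, (chaos S n).map (creation k)

variable {S : Finset ι}

theorem one_mem_chaos_zero : (1 : MvPolynomial ι ℝ) ∈ chaos S 0 :=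
  Submodule.mem_span_singleton_self 1

theorem creation_mem_chaos {n : ℕ} {k : ι} (hk : k ∈ S) {p : MvPolynomial ι ℝ}
    (hp : p ∈ chaos S n) : creation k p ∈ chaos S (n + 1) :=
  Submodule.mem_iSup_of_mem k (Submodule.mem_iSup_of_mem hk (Submodule.mem_map_of_mem hp))

theorem chaos_succ_le {n : ℕ} {Q : Submodule ℝ (MvPolynomial ι ℝ)}
    (h : ∀ k ∈ S, ∀ p ∈ chaos S n, creation k p ∈ Q) : chaos S (n + 1) ≤ Q :=
  iSup₂_le fun k hk => Submodule.map_le_iff_le_comap.2 fun p hp => h k hk p hp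

theorem chaos_mono {T : Finset ι} (h : S ⊆ T) (n : ℕ) : chaos S n ≤ chaos T n := by
  induction n with
  | zero => exact le_rfl
  | succ n ih => exact chaos_succ_le fun k hk p hp => creation_mem_chaos (h hk) (ih hp)

theorem pderiv_of_mem_chaos_zero (j : ι) {p : MvPolynomial ι ℝ} (hp : p ∈ chaos S 0) :
    pderiv j p = 0 := by
  obtain ⟨c, rfl⟩ := Submodule.mem_span_singleton.1 hp
  simp

theorem pderiv_mem_chaos (j : ι) {n : ℕ} {p : MvPolynomial ι ℝ} (hp : p ∈ chaos S (n + 1)) :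
    pderiv j p ∈ chaos S n := by
  induction n generalizing p with
  | zero =>
    have : chaos S 1 ≤ (chaos S 0).comap (pderiv j).toLinearMap := by
      refine chaos_succ_le fun k _ p hp => ?_
      change pderiv j (creation k p) ∈ chaos S 0
      by_cases h : j = k
      · subst h
        rw [pderiv_creation_self, pderiv_of_mem_chaos_zero j hp, map_zero, add_zero]
        exact hp
      · rw [pderiv_creation_of_ne h, pderiv_of_mem_chaos_zero j hp, map_zero]
        exact zero_mem _
    exact this hp
  | succ n ih =>
    have : chaos S (n + 2) ≤ (chaos S (n + 1)).comap (pderiv j).toLinearMap := by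
      refine chaos_succ_le fun k hk p hp => ?_
      change pderiv j (creation k p) ∈ chaos S (n + 1)
      by_cases h : j = k
      · subst h
        rw [pderiv_creation_self]
        exact add_mem hp (creation_mem_chaos hk (ih hp))
      · rw [pderiv_creation_of_ne h]
        exact creation_mem_chaos hk (ih hp)
    exact this hp

/-- The number operator in the variables in `S`. -/
noncomputable def numberOp (S : Finset ι) : MvPolynomial ι ℝ →ₗ[ℝ] MvPolynomial ι ℝ :=
  ∑ k ∈ S, creation k ∘ₗ (pderiv k).toLinearMap

theorem numberOp_apply (p : MvPolynomial ι ℝ) :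
    numberOp S p = ∑ k ∈ S, creation k (pderiv k p) := by
  simp [numberOp]

/-- The ladder relation: each creation operator raises the eigenvalue of the number operator by one,
so `chaos S n` consists of eigenvectors for `n`. -/
theorem numberOp_creation {j : ι} (hj : j ∈ S) (p : MvPolynomial ι ℝ) :
    numberOp S (creation j p) = creation j p + creation j (numberOp S p) := by
  classical
  have h : ∀ k ∈ S, creation k (pderiv k (creation j p)) =
      (if k = j then creation j p else 0) + creation j (creation k (pderiv k p)) := by
    intro k _
    split_ifs with hkj
    · subst hkj
      rw [pderiv_creation_self, map_add]
    · rw [pderiv_creation_of_ne hkj, creation_comm, zero_add]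
  rw [numberOp_apply, Finset.sum_congr rfl h, Finset.sum_add_distrib, Finset.sum_ite_eq' S j,
    if_pos hj, numberOp_apply, map_sum]

theorem numberOp_of_mem_chaos {n : ℕ} {p : MvPolynomial ι ℝ} (hp : p ∈ chaos S n) :
    numberOp S p = (n : ℝ) • p := by
  induction n generalizing p with
  | zero => simp [numberOp_apply, pderiv_of_mem_chaos_zero _ hp]
  | succ n ih =>
    have : chaos S (n + 1) ≤ LinearMap.ker (numberOp S - ((n + 1 : ℕ) : ℝ) • LinearMap.id) := by
      refine chaos_succ_le fun k hk p hp => ?_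
      rw [LinearMap.mem_ker, LinearMap.sub_apply, numberOp_creation hk, ih hp]
      simp only [map_smul, LinearMap.smul_apply, LinearMap.id_apply]
      push_cast
      module
    have := this hp
    rwa [LinearMap.mem_ker, LinearMap.sub_apply, sub_eq_zero] at this

/-- The sum of the chaoses of order at most `d`. -/
noncomputable def chaosLE (S : Finset ι) (d : ℕ) : Submodule ℝ (MvPolynomial ι ℝ) :=
  ⨆ m ∈ Finset.range (d + 1), chaos S m

theorem chaos_le_chaosLE {m d : ℕ} (h : m ≤ d) : chaos S m ≤ chaosLE S d :=
  le_biSup (chaos S) (Finset.mem_range.2 (Nat.lt_succ_of_le h))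

theorem chaosLE_mono {c d : ℕ} (h : c ≤ d) : chaosLE S c ≤ chaosLE S d :=
  iSup₂_le fun m hm => chaos_le_chaosLE (by have := Finset.mem_range.1 hm; omega)

theorem creation_mem_chaosLE {d : ℕ} {k : ι} (hk : k ∈ S) {p : MvPolynomial ι ℝ}
    (hp : p ∈ chaosLE S d) : creation k p ∈ chaosLE S (d + 1) := by
  have : chaosLE S d ≤ (chaosLE S (d + 1)).comap (creation k) :=
    iSup₂_le fun m hm p hp =>
      chaos_le_chaosLE (by have := Finset.mem_range.1 hm; omega) (creation_mem_chaos hk hp)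
  exact this hp

theorem pderiv_mem_chaosLE {d : ℕ} (k : ι) {p : MvPolynomial ι ℝ}
    (hp : p ∈ chaosLE S d) : pderiv k p ∈ chaosLE S d := by
  have : chaosLE S d ≤ (chaosLE S d).comap (pderiv k).toLinearMap := by
    refine iSup₂_le fun m hm p hp => ?_
    change pderiv k p ∈ chaosLE S d
    cases m with
    | zero => rw [pderiv_of_mem_chaos_zero k hp]; exact zero_mem _
    | succ m =>
      exact chaos_le_chaosLE (by have := Finset.mem_range.1 hm; omega) (pderiv_mem_chaos k hp)
  exact this hp

/-- Induction on the order of the first factor: the product rule moves a creation operator off it,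
at the cost of a derivative of the second factor, which does not raise the order. -/
theorem mul_mem_chaosLE {n d : ℕ} {p q : MvPolynomial ι ℝ} (hp : p ∈ chaos S n)
    (hq : q ∈ chaosLE S d) : p * q ∈ chaosLE S (n + d) := by
  induction n generalizing p q d with
  | zero =>
    obtain ⟨c, rfl⟩ := Submodule.mem_span_singleton.1 hp
    rw [smul_mul_assoc, one_mul, zero_add]
    exact Submodule.smul_mem _ c hq
  | succ n ih =>
    have : chaos S (n + 1) ≤ (chaosLE S (n + 1 + d)).comap (LinearMap.mulRight ℝ q) := by
      refine chaos_succ_le fun k hk p hp => ?_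
      have h : creation k p * q = creation k (p * q) + p * pderiv k q := by
        simp only [creation_apply, pderiv_mul]
        ring
      rw [Submodule.mem_comap, LinearMap.mulRight_apply, h]
      refine add_mem ?_ (chaosLE_mono (by omega) (ih hp (pderiv_mem_chaosLE k hq)))
      rw [show n + 1 + d = n + d + 1 by omega]
      exact creation_mem_chaosLE hk (ih hp hq)
    exact this hp

/-! ### Moment inequalities from integration by parts. -/

/-- A positive normalized functional on polynomials that satisfies the Gaussian integration by
parts formula. -/
structure IsGaussianExpectation (E : MvPolynomial ι ℝ →ₗ[ℝ] ℝ) : Prop where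
  map_one : E 1 = 1
  map_X_mul : ∀ k p, E (X k * p) = E (pderiv k p)
  map_sq_nonneg : ∀ p, 0 ≤ E (p ^ 2)

namespace IsGaussianExpectation

variable {E : MvPolynomial ι ℝ →ₗ[ℝ] ℝ}

theorem cauchy_schwarz (hE : IsGaussianExpectation E) (p q : MvPolynomial ι ℝ) :
    E (p * q) ^ 2 ≤ E (p ^ 2) * E (q ^ 2) := by
  have h : ∀ t : ℝ, 0 ≤ E (q ^ 2) * (t * t) + 2 * E (p * q) * t + E (p ^ 2) := by
    intro t
    have h1 : (p + t • q) ^ 2 = p ^ 2 + (2 * t) • (p * q) + (t * t) • q ^ 2 := by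
      simp only [smul_eq_C_mul, map_mul, map_ofNat]
      ring
    have := hE.map_sq_nonneg (p + t • q)
    rw [h1, map_add, map_add, map_smul, map_smul, smul_eq_mul, smul_eq_mul] at this
    linarith
  have := discrim_le_zero h
  rw [discrim] at this
  linarith

theorem map_mul_creation (hE : IsGaussianExpectation E) (k : ι) (p q : MvPolynomial ι ℝ) :
    E (p * creation k q) = E (pderiv k p * q) := by
  have h : p * creation k q = X k * (p * q) - p * pderiv k q := by
    rw [creation_apply]
    ring
  rw [h, map_sub, hE.map_X_mul, pderiv_mul, map_add, add_sub_cancel_right]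

theorem map_mul_numberOp (hE : IsGaussianExpectation E) (p q : MvPolynomial ι ℝ) :
    E (p * numberOp S q) = ∑ k ∈ S, E (pderiv k p * pderiv k q) := by
  simp only [numberOp_apply, Finset.mul_sum, map_sum, hE.map_mul_creation]

/-- Only `q` has to lie in a chaos over `S`; `p` may involve further variables, and the sum still
runs over `S`. The final limit argument relies on this asymmetry. -/
theorem map_mul_of_mem_chaos (hE : IsGaussianExpectation E) {n : ℕ} (p : MvPolynomial ι ℝ)
    {q : MvPolynomial ι ℝ} (hq : q ∈ chaos S n) :
    n * E (p * q) = ∑ k ∈ S, E (pderiv k p * pderiv k q) := by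
  rw [← hE.map_mul_numberOp, numberOp_of_mem_chaos hq, mul_smul_comm, map_smul, smul_eq_mul]

/-- Eigenvectors of a symmetric operator for distinct eigenvalues are orthogonal. -/
theorem map_mul_eq_zero (hE : IsGaussianExpectation E) {m n : ℕ} (hmn : m ≠ n)
    {p q : MvPolynomial ι ℝ} (hp : p ∈ chaos S m) (hq : q ∈ chaos S n) : E (p * q) = 0 := by
  have h1 := hE.map_mul_of_mem_chaos p hq
  have h2 := hE.map_mul_of_mem_chaos q hp
  simp only [mul_comm q p, fun k => mul_comm (pderiv k q) (pderiv k p)] at h2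
  have h3 : ((m : ℝ) - n) * E (p * q) = 0 := by linarith
  exact (mul_eq_zero.1 h3).resolve_left (sub_ne_zero.2 (Nat.cast_injective.ne hmn))

theorem map_pow_four_of_mem_chaos (hE : IsGaussianExpectation E) {n : ℕ}
    {p : MvPolynomial ι ℝ} (hp : p ∈ chaos S n) :
    n * E (p ^ 4) = 3 * ∑ k ∈ S, E (p ^ 2 * pderiv k p ^ 2) := by
  rw [show p ^ 4 = p ^ 3 * p by ring, hE.map_mul_of_mem_chaos _ hp, Finset.mul_sum]
  refine Finset.sum_congr rfl fun k _ => ?_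
  have h : pderiv k (p ^ 3) * pderiv k p = (3 : ℝ) • (p ^ 2 * pderiv k p ^ 2) := by
    rw [pderiv_pow, smul_eq_C_mul, map_ofNat]
    push_cast
    ring
  rw [h, map_smul, smul_eq_mul]

theorem map_sq_of_mem_chaos (hE : IsGaussianExpectation E) {n : ℕ}
    {p : MvPolynomial ι ℝ} (hp : p ∈ chaos S n) :
    n * E (p ^ 2) = ∑ k ∈ S, E (pderiv k p ^ 2) := by
  simp only [pow_two, hE.map_mul_of_mem_chaos p hp]

/-- Hypercontractivity: on a fixed chaos the fourth moment is controlled by the second one. -/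
theorem map_pow_four_le (hE : IsGaussianExpectation E) {n : ℕ}
    {p : MvPolynomial ι ℝ} (hp : p ∈ chaos S n) : E (p ^ 4) ≤ (3 ^ n * E (p ^ 2)) ^ 2 := by
  induction n generalizing p with
  | zero =>
    obtain ⟨c, rfl⟩ := Submodule.mem_span_singleton.1 hp
    simp only [smul_pow, one_pow, map_smul, hE.map_one, smul_eq_mul]
    nlinarith
  | succ n ih =>
    have h4 : ∀ q : MvPolynomial ι ℝ, 0 ≤ E (q ^ 4) := fun q => by
      rw [show q ^ 4 = (q ^ 2) ^ 2 by ring]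
      exact hE.map_sq_nonneg _
    -- Cauchy–Schwarz, with the induction hypothesis applied to the derivative, which has order `n`.
    have hterm : ∀ k ∈ S, E (p ^ 2 * pderiv k p ^ 2) ≤
        √(E (p ^ 4)) * (3 ^ n * E (pderiv k p ^ 2)) := by
      intro k _
      have h1 := hE.cauchy_schwarz (p ^ 2) (pderiv k p ^ 2)
      rw [← pow_mul, ← pow_mul] at h1
      have h2 : 0 ≤ 3 ^ n * E (pderiv k p ^ 2) := mul_nonneg (by positivity) (hE.map_sq_nonneg _)
      refine abs_le_of_sq_le_sq' ?_ (mul_nonneg (Real.sqrt_nonneg _) h2) |>.2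
      rw [mul_pow, Real.sq_sqrt (h4 p)]
      exact h1.trans (mul_le_mul_of_nonneg_left (ih (pderiv_mem_chaos k hp)) (h4 p))
    have hsum : ((n + 1 : ℕ) : ℝ) * E (p ^ 4) ≤
        ((n + 1 : ℕ) : ℝ) * (√(E (p ^ 4)) * (3 ^ (n + 1) * E (p ^ 2))) := by
      calc ((n + 1 : ℕ) : ℝ) * E (p ^ 4) = 3 * ∑ k ∈ S, E (p ^ 2 * pderiv k p ^ 2) :=
            hE.map_pow_four_of_mem_chaos hp
        _ ≤ 3 * ∑ k ∈ S, √(E (p ^ 4)) * (3 ^ n * E (pderiv k p ^ 2)) := by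
            gcongr with k hk
            exact hterm k hk
        _ = 3 * (√(E (p ^ 4)) * (3 ^ n * (((n + 1 : ℕ) : ℝ) * E (p ^ 2)))) := by
            simp only [hE.map_sq_of_mem_chaos hp, Finset.mul_sum]
        _ = _ := by ring
    have h5 := le_of_mul_le_mul_left hsum (by positivity)
    -- Division by `√(E (p ^ 4))`; if it vanishes the bound is trivial.
    have h6 : √(E (p ^ 4)) ≤ 3 ^ (n + 1) * E (p ^ 2) := by
      rcases (Real.sqrt_nonneg (E (p ^ 4))).eq_or_lt with h | h
      · rw [← h]
        exact mul_nonneg (by positivity) (hE.map_sq_nonneg _)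
      · refine le_of_mul_le_mul_left ?_ h
        rwa [Real.mul_self_sqrt (h4 p)]
    calc E (p ^ 4) = √(E (p ^ 4)) ^ 2 := (Real.sq_sqrt (h4 p)).symm
      _ ≤ _ := by gcongr

/-- A spectral gap estimate: on polynomials `g` of degree at most `d`, the number operator is at
most `d`, and the components of `g` of order `0` and `2` improve on that. -/
theorem spectral_gap (hE : IsGaussianExpectation E) {d : ℕ} (hd : 2 ≤ d)
    {g h : MvPolynomial ι ℝ} (hg : g ∈ chaosLE S d) (hh : h ∈ chaos S 2) :
    d * E g ^ 2 * E (h ^ 2) + (d - 2) * E (g * h) ^ 2 ≤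
      (d * E (g ^ 2) - E (g * numberOp S g)) * E (h ^ 2) := by
  classical
  obtain ⟨J, rfl⟩ := (Submodule.mem_iSup_finset_iff_exists_sum (chaos S) g).1 hg
  set s := Finset.range (d + 1) with hs
  have h0 : 0 ∈ s := Finset.mem_range.2 (by omega)
  have h2 : 2 ∈ s := Finset.mem_range.2 (by omega)
  have hpair : ∀ m n, ∀ q ∈ chaos S n, m ≠ n → E ((J m : MvPolynomial ι ℝ) * q) = 0 :=
    fun m n q hq hmn => hE.map_mul_eq_zero hmn (J m).2 hq
  have hsum : ∀ n ∈ s, ∀ q ∈ chaos S n,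
      E ((∑ m ∈ s, (J m : MvPolynomial ι ℝ)) * q) = E (J n * q) := by
    intro n hn q hq
    rw [Finset.sum_mul, map_sum, Finset.sum_eq_single_of_mem n hn]
    intro m _ hmn
    exact hpair m n q hq hmn
  have hE0 : E (∑ m ∈ s, (J m : MvPolynomial ι ℝ)) = E (J 0) := by
    simpa using hsum 0 h0 1 one_mem_chaos_zero
  have hE2 : E ((∑ m ∈ s, (J m : MvPolynomial ι ℝ)) * h) = E (J 2 * h) := hsum 2 h2 h hh
  have hsq : E ((∑ m ∈ s, (J m : MvPolynomial ι ℝ)) ^ 2) =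
      ∑ m ∈ s, E ((J m : MvPolynomial ι ℝ) ^ 2) := by
    rw [pow_two, Finset.mul_sum, map_sum]
    refine Finset.sum_congr rfl fun m hm => ?_
    rw [hsum m hm _ (J m).2, pow_two]
  have hN : E ((∑ m ∈ s, (J m : MvPolynomial ι ℝ)) * numberOp S (∑ m ∈ s, J m)) =
      ∑ m ∈ s, m * E ((J m : MvPolynomial ι ℝ) ^ 2) := by
    rw [map_sum, Finset.mul_sum, map_sum]
    refine Finset.sum_congr rfl fun m hm => ?_
    rw [numberOp_of_mem_chaos (J m).2, mul_smul_comm, map_smul, hsum m hm _ (J m).2, pow_two,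
      smul_eq_mul]
  -- All weights `d - m` are nonnegative on `s`, so every term except those of order 0 and 2 may be
  -- dropped.
  have hlow : (d : ℝ) * E ((J 0 : MvPolynomial ι ℝ) ^ 2) +
      (d - 2) * E ((J 2 : MvPolynomial ι ℝ) ^ 2) ≤
      ∑ m ∈ s, ((d : ℝ) - m) * E ((J m : MvPolynomial ι ℝ) ^ 2) := by
    calc _ = ∑ m ∈ ({0, 2} : Finset ℕ), ((d : ℝ) - m) * E ((J m : MvPolynomial ι ℝ) ^ 2) := by
          rw [Finset.sum_pair (by norm_num)]
          simp
      _ ≤ _ := by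
          refine Finset.sum_le_sum_of_subset_of_nonneg ?_ fun m hm _ => ?_
          · intro m hm
            rcases Finset.mem_insert.1 hm with rfl | hm
            · exact h0
            · rwa [Finset.mem_singleton.1 hm]
          · have : (m : ℝ) ≤ d := by
              exact_mod_cast Nat.le_of_lt_succ (Finset.mem_range.1 hm)
            exact mul_nonneg (by linarith) (hE.map_sq_nonneg _)
  rw [hE0, hE2, hsq, hN, Finset.mul_sum, ← Finset.sum_sub_distrib]
  simp only [← sub_mul]
  have hc0 := hE.cauchy_schwarz (J 0) 1
  rw [mul_one, one_pow, hE.map_one, mul_one] at hc0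
  have hc2 := hE.cauchy_schwarz (J 2) h
  have hh0 := hE.map_sq_nonneg h
  have hd' : (2 : ℝ) ≤ d := by exact_mod_cast hd
  calc _ ≤ (d * E ((J 0 : MvPolynomial ι ℝ) ^ 2) +
      (d - 2) * E ((J 2 : MvPolynomial ι ℝ) ^ 2)) * E (h ^ 2) := by
        rw [add_mul, mul_assoc (_ - _)]
        exact add_le_add (by gcongr) (mul_le_mul_of_nonneg_left hc2 (by linarith))
    _ ≤ _ := mul_le_mul_of_nonneg_right hlow hh0

/-- The quantitative fourth moment inequality on a fixed chaos. -/
theorem map_pow_four_ge (hE : IsGaussianExpectation E) {n : ℕ} (hn : 1 ≤ n)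
    {p : MvPolynomial ι ℝ} (hp : p ∈ chaos S n) {k : ι} (hk : k ∈ S) :
    6 * (n - 1) * E (pderiv k p ^ 2) ^ 2 ≤ n * (E (p ^ 4) - 3 * E (p ^ 2) ^ 2) := by
  -- This is `X k ^ 2 - 1`, the second Hermite polynomial.
  set h : MvPolynomial ι ℝ := creation k (creation k 1) with hh
  have hh2 : h ∈ chaos S 2 :=
    creation_mem_chaos hk (creation_mem_chaos hk one_mem_chaos_zero)
  have hhh : E (h ^ 2) = 2 := by
    rw [pow_two, hh, hE.map_mul_creation, hE.map_mul_creation]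
    simp only [pderiv_creation_self, map_add, pderiv_one, map_zero, add_zero, mul_one, hE.map_one]
    norm_num
  have hp2 : p ^ 2 ∈ chaosLE S (2 * n) := by
    rw [pow_two, two_mul]
    exact mul_mem_chaosLE hp (chaos_le_chaosLE le_rfl hp)
  have hph : E (p ^ 2 * h) = 2 * E (pderiv k p ^ 2) := by
    rw [hh, hE.map_mul_creation, hE.map_mul_creation, mul_one]
    have h1 : pderiv k (pderiv k (p ^ 2)) =
        (2 : ℝ) • pderiv k p ^ 2 + (2 : ℝ) • (p * pderiv k (pderiv k p)) := by
      rw [pow_two, pderiv_mul, map_add, pderiv_mul, pderiv_mul, smul_eq_C_mul, smul_eq_C_mul,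
        map_ofNat]
      ring
    -- The second derivative has order `n - 2`, hence is orthogonal to `p`; for `n = 1` it is zero.
    have h2 : E (p * pderiv k (pderiv k p)) = 0 := by
      obtain ⟨m, rfl⟩ : ∃ m, n = m + 1 := ⟨n - 1, by omega⟩
      have h3 := pderiv_mem_chaos k hp
      cases m with
      | zero => rw [pderiv_of_mem_chaos_zero k h3, mul_zero, map_zero]
      | succ m => exact hE.map_mul_eq_zero (by omega) hp (pderiv_mem_chaos k h3)
    rw [h1, map_add, map_smul, map_smul, h2, smul_eq_mul, smul_zero, add_zero]
  have hN : 3 * E (p ^ 2 * numberOp S (p ^ 2)) = 4 * (n * E (p ^ 4)) := by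
    rw [hE.map_mul_numberOp, hE.map_pow_four_of_mem_chaos hp]
    have h1 : ∀ k, E (pderiv k (p ^ 2) * pderiv k (p ^ 2)) = 4 * E (p ^ 2 * pderiv k p ^ 2) := by
      intro k
      have h2 : pderiv k (p ^ 2) * pderiv k (p ^ 2) = (4 : ℝ) • (p ^ 2 * pderiv k p ^ 2) := by
        rw [pderiv_pow, smul_eq_C_mul, map_ofNat]
        push_cast
        ring
      rw [h2, map_smul, smul_eq_mul]
    simp only [h1, Finset.mul_sum]
    exact Finset.sum_congr rfl fun k _ => by ring
  -- With `d = 2 * n`, the right-hand factor becomes `(2 * n - 4 * n / 3) * E (p ^ 4)`.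
  have hgap := hE.spectral_gap (by omega) hp2 hh2
  rw [hhh, hph, ← pow_mul] at hgap
  push_cast at hgap
  linarith

end IsGaussianExpectation

end PolynomialChaos

/-! ### Gaussian integration by parts -/

section GaussianMoments

theorem integrable_pow_gaussianReal (m : ℕ) :
    Integrable (fun x : ℝ => x ^ m) (gaussianReal 0 1) := by
  rw [← integrable_norm_iff (by fun_prop)]
  have := (memLp_id_gaussianReal (μ := 0) (v := 1) (m : NNReal)).integrable_norm_pow'
  simpa using this

/-- Integration by parts for the moments of the standard normal law. -/
theorem integral_pow_succ_gaussianReal (m : ℕ) :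
    ∫ x, x ^ (m + 1) ∂(gaussianReal 0 1) = m * ∫ x, x ^ (m - 1) ∂(gaussianReal 0 1) := by
  have hint : ∀ m : ℕ, Integrable (fun x : ℝ => gaussianPDFReal 0 1 x * x ^ m) := by
    intro m
    have := integrable_pow_gaussianReal m
    rw [gaussianReal_of_var_ne_zero 0 one_ne_zero, integrable_withDensity_iff_integrable_smul'
      (measurable_gaussianPDF 0 1) (ae_of_all _ fun x => gaussianPDF_lt_top)] at this
    simpa [toReal_gaussianPDF] using this
  have hderiv : ∀ x : ℝ, HasDerivAt (gaussianPDFReal 0 1) (-(gaussianPDFReal 0 1 x * x)) x := by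
    intro x
    have h1 : HasDerivAt (fun x : ℝ => -(x - 0) ^ 2 / (2 * ((1 : NNReal) : ℝ))) (-x) x := by
      have := ((((hasDerivAt_id x).sub_const 0).pow 2).neg).div_const (2 * ((1 : NNReal) : ℝ))
      refine this.congr_deriv ?_
      simp
      ring
    refine ((h1.exp).const_mul (√(2 * Real.pi * ((1 : NNReal) : ℝ)))⁻¹).congr_deriv ?_
    rw [gaussianPDFReal]
    ring
  -- For `m = 0` the truncated exponent `m - 1` is harmless because its coefficient vanishes.
  have hprod : ∀ x : ℝ, HasDerivAt (fun x => gaussianPDFReal 0 1 x * x ^ m)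
      (m * (gaussianPDFReal 0 1 x * x ^ (m - 1)) - gaussianPDFReal 0 1 x * x ^ (m + 1)) x := by
    intro x
    refine ((hderiv x).mul (hasDerivAt_pow m x)).congr_deriv ?_
    ring
  have key := integral_eq_zero_of_hasDerivAt_of_integrable hprod
    (((hint _).const_mul _).sub (hint _)) (hint m)
  rw [integral_sub ((hint _).const_mul _) (hint _), integral_const_mul] at key
  rw [integral_gaussianReal_eq_integral_smul one_ne_zero,
    integral_gaussianReal_eq_integral_smul one_ne_zero]
  simp only [smul_eq_mul]
  linarith

variable {Ω : Type*} [MeasurableSpace Ω] {P : Measure Ω}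

theorem map_eq_gaussianReal_zero_one {Y : Ω → ℝ} (hY : HasGaussianLaw Y P)
    (h1 : ∫ ω, Y ω ∂P = 0) (h2 : ∫ ω, Y ω ^ 2 ∂P = 1) : P.map Y = gaussianReal 0 1 := by
  have hvar : Var[Y; P] = 1 := by
    rw [variance_of_integral_eq_zero hY.aemeasurable h1]
    exact h2
  rw [hY.map_eq_gaussianReal, hvar, h1, Real.toNNReal_one]

/-- The fourth moment of the standard normal law is `3`. -/
theorem integral_pow_four_of_hasGaussianLaw {Y : Ω → ℝ} (hY : HasGaussianLaw Y P)
    (h1 : ∫ ω, Y ω ∂P = 0) (h2 : ∫ ω, Y ω ^ 2 ∂P = 1) : ∫ ω, Y ω ^ 4 ∂P = 3 := by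
  have hmap : ∀ m : ℕ, ∫ ω, Y ω ^ m ∂P = ∫ x, x ^ m ∂(gaussianReal 0 1) := fun m => by
    rw [← map_eq_gaussianReal_zero_one hY h1 h2, integral_map hY.aemeasurable (by fun_prop)]
  rw [hmap] at h2 ⊢
  rw [integral_pow_succ_gaussianReal 3, h2]
  norm_num

end GaussianMoments

/-! ### The coordinates of an isonormal process as independent standard normal variables. -/

section IsonormalExpectation

variable {H Ω ι : Type*} [NormedAddCommGroup H] [InnerProductSpace ℝ H] [MeasurableSpace Ω]
  {P : Measure Ω} {X : H → Ω → ℝ}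

theorem IsIsonormal.map_eq_gaussianReal (hX : IsIsonormal X P) (e : HilbertBasis ι ℝ H) (k : ι) :
    P.map (X (e k)) = gaussianReal 0 1 := by
  refine map_eq_gaussianReal_zero_one (hX.isGaussianProcess.hasGaussianLaw_eval _)
    (hX.centered _) ?_
  simp only [pow_two, hX.covariance]
  simp [e.orthonormal.1 k]

theorem IsIsonormal.integral_pow (hX : IsIsonormal X P) (e : HilbertBasis ι ℝ H) (k : ι) (m : ℕ) :
    ∫ ω, X (e k) ω ^ m ∂P = ∫ x, x ^ m ∂(gaussianReal 0 1) := by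
  rw [← hX.map_eq_gaussianReal e k,
    integral_map (hX.isGaussianProcess.aemeasurable _) (by fun_prop)]

/-- Jointly Gaussian and uncorrelated families are independent; orthonormality of `e` supplies the
zero covariances. -/
theorem IsIsonormal.indepFun_rest (hX : IsIsonormal X P) (e : HilbertBasis ι ℝ H) (k : ι) :
    IndepFun (X (e k)) (fun ω (j : {j // j ≠ k}) => X (e j) ω) P := by
  have h : IsGaussianProcess (Sum.elim (fun _ : Unit => X (e k))
      (fun j : {j // j ≠ k} => X (e j))) P := by
    have := hX.isGaussianProcess.comp_right
      (Sum.elim (fun _ : Unit => e k) (fun j : {j // j ≠ k} => e j))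
    have heq : Sum.elim (fun _ : Unit => X (e k)) (fun j : {j // j ≠ k} => X (e j)) =
        X ∘ Sum.elim (fun _ : Unit => e k) (fun j : {j // j ≠ k} => e j) := by
      funext j
      cases j <;> rfl
    rw [heq]
    exact this
  have hind := h.indepFun_of_covariance_eq_zero
    (fun _ => hX.isGaussianProcess.aemeasurable _) (fun _ => hX.isGaussianProcess.aemeasurable _)
    (fun _ j => by
      have := hX.isGaussianProcess.isProbabilityMeasure
      rw [covariance_eq_sub (hX.isGaussianProcess.hasGaussianLaw_eval _).memLp_two
        (hX.isGaussianProcess.hasGaussianLaw_eval _).memLp_two]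
      have h0 := e.orthonormal.2 j.2.symm
      simp [hX.centered, hX.covariance, h0])
  exact hind.comp (measurable_pi_apply ()) measurable_id

variable [IsProbabilityMeasure P]

theorem IsIsonormal.memLp_aeval (hX : IsIsonormal X P) (e : HilbertBasis ι ℝ H)
    (p : MvPolynomial ι ℝ) : ∀ q : ℝ≥0∞, q ≠ ∞ →
      MemLp (fun ω => MvPolynomial.aeval (fun k => X (e k) ω) p) q P := by
  induction p using MvPolynomial.induction_on with
  | C a => intro q _; simpa using memLp_const a
  | add p p' hp hp' =>
    intro q hq
    simp only [map_add]
    exact (hp q hq).add (hp' q hq)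
  | mul_X p k hp =>
    intro q hq
    simp only [map_mul, MvPolynomial.aeval_X]
    exact memLp_mul_of_forall hp
      (fun r hr => (hX.isGaussianProcess.hasGaussianLaw_eval _).memLp hr) q hq

theorem IsIsonormal.integrable_aeval (hX : IsIsonormal X P) (e : HilbertBasis ι ℝ H)
    (p : MvPolynomial ι ℝ) :
    Integrable (fun ω => MvPolynomial.aeval (fun k => X (e k) ω) p) P :=
  memLp_one_iff_integrable.1 (hX.memLp_aeval e p 1 (by simp))

/-- The expectation of polynomials in the independent standard normal variables `X(e k)`. -/
noncomputable def IsIsonormal.expectation (hX : IsIsonormal X P) (e : HilbertBasis ι ℝ H) :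
    MvPolynomial ι ℝ →ₗ[ℝ] ℝ where
  toFun p := ∫ ω, MvPolynomial.aeval (fun k => X (e k) ω) p ∂P
  map_add' p q := by
    simp only [map_add]
    exact integral_add (hX.integrable_aeval e p) (hX.integrable_aeval e q)
  map_smul' c p := by
    simp only [map_smul, smul_eq_mul, RingHom.id_apply]
    exact integral_const_mul _ _

theorem IsIsonormal.expectation_apply (hX : IsIsonormal X P) (e : HilbertBasis ι ℝ H)
    (p : MvPolynomial ι ℝ) :
    hX.expectation e p = ∫ ω, MvPolynomial.aeval (fun k => X (e k) ω) p ∂P := rfl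

theorem IsIsonormal.expectation_pow_mul_monomial (hX : IsIsonormal X P) (e : HilbertBasis ι ℝ H)
    (k : ι) (m : ℕ) {s : ι →₀ ℕ} (hs : s k = 0) (c : ℝ) :
    hX.expectation e (MvPolynomial.X k ^ m * MvPolynomial.monomial s c) =
      (∫ x, x ^ m ∂(gaussianReal 0 1)) * hX.expectation e (MvPolynomial.monomial s c) := by
  classical
  have hmeas : ∀ j, AEMeasurable (X (e j)) P := fun j => hX.isGaussianProcess.aemeasurable _
  -- The monomial as a function of the other coordinates; since `s k = 0`, the default factor 1 is
  -- never used.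
  let ψ : ({j // j ≠ k} → ℝ) → ℝ := fun y =>
    c * ∏ j ∈ s.support, if h : j ≠ k then y ⟨j, h⟩ ^ s j else 1
  have hψm : Measurable ψ := by
    refine (Finset.measurable_prod _ fun j _ => ?_).const_mul c
    split_ifs
    · fun_prop
    · fun_prop
  have hψ : ∀ ω, MvPolynomial.aeval (fun k => X (e k) ω) (MvPolynomial.monomial s c) =
      ψ (fun j => X (e j) ω) := by
    intro ω
    rw [MvPolynomial.aeval_monomial, Finsupp.prod]
    refine congrArg (c * ·) (Finset.prod_congr rfl fun j hj => ?_)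
    have : j ≠ k := fun h => Finsupp.mem_support_iff.1 hj (h ▸ hs)
    rw [dif_pos this]
  have hind := (hX.indepFun_rest e k).comp (φ := fun x => x ^ m) (by fun_prop) hψm
  rw [hX.expectation_apply, hX.expectation_apply, ← hX.integral_pow e k]
  simp only [map_mul, map_pow, MvPolynomial.aeval_X]
  refine IndepFun.integral_fun_mul_eq_mul_integral (X := fun ω => X (e k) ω ^ m) ?_
    ((hmeas k).pow_const m).aestronglyMeasurable (hX.integrable_aeval e _).aestronglyMeasurable
  simp only [hψ]
  exact hind

theorem IsIsonormal.isGaussianExpectation (hX : IsIsonormal X P) (e : HilbertBasis ι ℝ H) :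
    IsGaussianExpectation (hX.expectation e) where
  map_one := by simp [hX.expectation_apply]
  map_sq_nonneg p := by
    rw [hX.expectation_apply]
    exact integral_nonneg fun ω => by simpa using sq_nonneg _
  map_X_mul k p := by
    classical
    induction p using MvPolynomial.induction_on' with
    | add p q hp hq => rw [mul_add, map_add, map_add, map_add, hp, hq]
    | monomial s c =>
      -- Splitting off the power of `X k` reduces the claim to one-dimensional integration by parts.
      have hs : MvPolynomial.monomial s c =
          MvPolynomial.X k ^ s k * MvPolynomial.monomial (s.erase k) c := by
        rw [MvPolynomial.X_pow_eq_monomial, MvPolynomial.monomial_mul, one_mul,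
          Finsupp.single_add_erase]
      have h0 : MvPolynomial.pderiv k (MvPolynomial.monomial (s.erase k) c) = 0 := by
        rw [MvPolynomial.pderiv_monomial]
        simp
      have h1 : MvPolynomial.pderiv k (MvPolynomial.monomial s c) =
          (s k : ℝ) • (MvPolynomial.X k ^ (s k - 1) * MvPolynomial.monomial (s.erase k) c) := by
        rw [hs, MvPolynomial.pderiv_mul, h0, MvPolynomial.pderiv_pow,
          MvPolynomial.pderiv_X_self, MvPolynomial.smul_eq_C_mul, map_natCast]
        ring
      rw [h1, hs, ← mul_assoc, ← pow_succ', map_smul,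
        hX.expectation_pow_mul_monomial e k _ (by simp),
        hX.expectation_pow_mul_monomial e k _ (by simp), integral_pow_succ_gaussianReal,
        smul_eq_mul, mul_assoc]

end IsonormalExpectation

/-! ### Hermite products as elements of a chaos. -/

section HermitePolynomials

open MvPolynomial

variable {ι : Type*}

theorem pderiv_aeval_X (k : ι) (q : Polynomial ℤ) :
    pderiv (R := ℝ) k (Polynomial.aeval (X k) q) = Polynomial.aeval (X k) q.derivative := by
  have h := ((pderiv (R := ℝ) k).restrictScalars ℤ).map_aeval q (X k)
  rw [Derivation.restrictScalars_apply, Derivation.restrictScalars_apply, pderiv_X_self,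
    smul_eq_mul, mul_one] at h
  exact h

theorem pderiv_eq_zero_of_mem_chaos {T : Finset ι} {n : ℕ} {j : ι} (hj : j ∉ T)
    {p : MvPolynomial ι ℝ} (hp : p ∈ chaos T n) : pderiv j p = 0 := by
  induction n generalizing p with
  | zero => exact pderiv_of_mem_chaos_zero j hp
  | succ n ih =>
    have : chaos T (n + 1) ≤ LinearMap.ker (pderiv j).toLinearMap := by
      refine chaos_succ_le fun k hk p hp => ?_
      change pderiv j (creation k p) = 0
      rw [pderiv_creation_of_ne (by rintro rfl; exact hj hk), ih hp, map_zero]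
    exact this hp

/-- The Hermite recurrence `He_{m+1} = x He_m - He_m'` is the creation operator; as `p` does not
involve `X k`, it passes through as a constant. -/
theorem hermite_mul_mem_chaos [DecidableEq ι] {T : Finset ι} {d : ℕ} {k : ι} (hk : k ∉ T)
    {p : MvPolynomial ι ℝ} (hp : p ∈ chaos T d) (m : ℕ) :
    Polynomial.aeval (X k) (Polynomial.hermite m) * p ∈ chaos (insert k T) (m + d) := by
  induction m with
  | zero => simpa using chaos_mono (Finset.subset_insert k T) d hp
  | succ m ih =>
    have h : Polynomial.aeval (X k) (Polynomial.hermite (m + 1)) * p =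
        creation k (Polynomial.aeval (X k) (Polynomial.hermite m) * p) := by
      rw [creation_apply, pderiv_mul, pderiv_eq_zero_of_mem_chaos hk hp, pderiv_aeval_X,
        Polynomial.hermite_succ, map_sub, map_mul, Polynomial.aeval_X]
      ring
    rw [h, show m + 1 + d = m + d + 1 by omega]
    exact creation_mem_chaos (Finset.mem_insert_self k T) ih

theorem prod_hermite_mem_chaos (T : Finset ι) (m : ι → ℕ) :
    ∏ k ∈ T, Polynomial.aeval (X k : MvPolynomial ι ℝ) (Polynomial.hermite (m k)) ∈
      chaos T (∑ k ∈ T, m k) := by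
  classical
  induction T using Finset.induction_on with
  | empty => exact one_mem_chaos_zero
  | insert k T hk ih =>
    rw [Finset.prod_insert hk, Finset.sum_insert hk]
    exact hermite_mul_mem_chaos hk ih (m k)

open Classical in
/-- The polynomial `∏ₖ He_{m(k)}(Xₖ)`, where `m(k)` is the number of times that `k` occurs
among `i₁, …, iₙ`. -/
noncomputable def hermitePoly {n : ℕ} (i : Fin n → ι) : MvPolynomial ι ℝ :=
  ∏ k ∈ Finset.univ.image i,
    Polynomial.aeval (X k) (Polynomial.hermite (Finset.univ.filter fun j => i j = k).card)

open Classical in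
theorem hermitePoly_mem_chaos {n : ℕ} (i : Fin n → ι) {S : Finset ι}
    (hS : Finset.univ.image i ⊆ S) : hermitePoly i ∈ chaos S n := by
  have h := prod_hermite_mem_chaos (Finset.univ.image i)
    (fun k => (Finset.univ.filter fun j => i j = k).card)
  rw [← Finset.card_eq_sum_card_image, Finset.card_univ, Fintype.card_fin] at h
  exact chaos_mono hS n h

open Classical in
theorem aeval_hermitePoly {H Ω : Type*} [NormedAddCommGroup H] [InnerProductSpace ℝ H]
    (Y : H → Ω → ℝ) (e : HilbertBasis ι ℝ H) {n : ℕ} (i : Fin n → ι) (ω : Ω) :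
    aeval (fun k => Y (e k) ω) (hermitePoly i) = hermiteProd Y e i ω := by
  simp only [hermitePoly, hermiteProd, map_prod]
  refine Finset.prod_congr rfl fun k _ => ?_
  have h := Polynomial.aeval_algHom_apply
    ((aeval (R := ℝ) fun k => Y (e k) ω).restrictScalars ℤ) (X k)
    (Polynomial.hermite (Finset.univ.filter fun j => i j = k).card)
  simpa using h.symm

end HermitePolynomials

/-! ### The fourth moment on the closure of a chaos -/

section ChaosClosure

open Filter Topology

variable {H Ω ι : Type*} [NormedAddCommGroup H] [InnerProductSpace ℝ H] [MeasurableSpace Ω]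
  {P : Measure Ω} {X : H → Ω → ℝ}

instance fact_one_le_four_ennreal : Fact ((1 : ℝ≥0∞) ≤ 4) := ⟨by norm_num⟩

theorem norm_pow_four_eq_integral (g : Lp ℝ 4 P) : ‖g‖ ^ 4 = ∫ ω, g ω ^ 4 ∂P := by
  have hnn : 0 ≤ ∫ ω, g ω ^ 4 ∂P := integral_nonneg fun ω => by positivity
  have h := (Lp.memLp g).eLpNorm_eq_integral_rpow_norm (by norm_num) (by norm_num)
  have h4 : ∀ x : ℝ, ‖x‖ ^ (4 : ℝ) = x ^ 4 := fun x => by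
    rw [show (4 : ℝ) = ((4 : ℕ) : ℝ) by norm_num, Real.rpow_natCast, Real.norm_eq_abs]
    exact Even.pow_abs (by decide) x
  rw [ENNReal.toReal_ofNat] at h
  simp only [h4] at h
  rw [Lp.norm_def, h, ENNReal.toReal_ofReal (by positivity),
    ← Real.rpow_natCast, ← Real.rpow_mul hnn]
  norm_num

theorem norm_sq_eq_integral (g : Lp ℝ 2 P) : ‖g‖ ^ 2 = ∫ ω, g ω ^ 2 ∂P := by
  rw [← real_inner_self_eq_norm_sq, L2.inner_def]
  simp [pow_two]

variable [IsProbabilityMeasure P]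

/-- The polynomials in the variables `X(e k)` as elements of `L^q`. -/
noncomputable def IsIsonormal.toLp (hX : IsIsonormal X P) (e : HilbertBasis ι ℝ H) (q : ℝ≥0∞)
    (hq : q ≠ ∞) : MvPolynomial ι ℝ →ₗ[ℝ] Lp ℝ q P where
  toFun p := (hX.memLp_aeval e p q hq).toLp _
  map_add' p p' := by
    rw [← MemLp.toLp_add]
    refine MemLp.toLp_congr _ _ (ae_of_all _ fun ω => ?_)
    simp
  map_smul' c p := by
    rw [RingHom.id_apply, ← MemLp.toLp_const_smul]
    refine MemLp.toLp_congr _ _ (ae_of_all _ fun ω => ?_)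
    simp

theorem IsIsonormal.coeFn_toLp (hX : IsIsonormal X P) (e : HilbertBasis ι ℝ H) {q : ℝ≥0∞}
    (hq : q ≠ ∞) (p : MvPolynomial ι ℝ) :
    hX.toLp e q hq p =ᵐ[P] fun ω => MvPolynomial.aeval (fun k => X (e k) ω) p :=
  (hX.memLp_aeval e p q hq).coeFn_toLp

theorem IsIsonormal.inner_toLp (hX : IsIsonormal X P) (e : HilbertBasis ι ℝ H)
    (p q : MvPolynomial ι ℝ) :
    inner ℝ (hX.toLp e 2 (by simp) p) (hX.toLp e 2 (by simp) q) = hX.expectation e (p * q) := by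
  rw [L2.inner_def, hX.expectation_apply]
  refine integral_congr_ae ?_
  filter_upwards [hX.coeFn_toLp e (q := 2) (by simp) p, hX.coeFn_toLp e (q := 2) (by simp) q]
    with ω h1 h2
  rw [h1, h2, map_mul]
  simp [mul_comm]

theorem IsIsonormal.norm_toLp_two_sq (hX : IsIsonormal X P) (e : HilbertBasis ι ℝ H)
    (p : MvPolynomial ι ℝ) :
    ‖hX.toLp e 2 (by simp) p‖ ^ 2 = hX.expectation e (p ^ 2) := by
  rw [← real_inner_self_eq_norm_sq, hX.inner_toLp, pow_two]

theorem IsIsonormal.norm_toLp_four_pow (hX : IsIsonormal X P) (e : HilbertBasis ι ℝ H)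
    (p : MvPolynomial ι ℝ) :
    ‖hX.toLp e 4 (by simp) p‖ ^ 4 = hX.expectation e (p ^ 4) := by
  rw [norm_pow_four_eq_integral, hX.expectation_apply]
  refine integral_congr_ae ?_
  filter_upwards [hX.coeFn_toLp e (q := 4) (by simp) p] with ω h1
  rw [h1, map_pow]

theorem IsIsonormal.norm_toLp_four_le (hX : IsIsonormal X P) (e : HilbertBasis ι ℝ H)
    {S : Finset ι} {n : ℕ} {p : MvPolynomial ι ℝ} (hp : p ∈ chaos S n) :
    ‖hX.toLp e 4 (by simp) p‖ ≤ 3 ^ n * ‖hX.toLp e 2 (by simp) p‖ := by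
  refine le_of_pow_le_pow_left₀ (n := 4) (by norm_num) (by positivity) ?_
  rw [hX.norm_toLp_four_pow]
  refine ((hX.isGaussianExpectation e).map_pow_four_le hp).trans ?_
  rw [← hX.norm_toLp_two_sq]
  -- The fourth-moment bound gives the constant `3 ^ (n / 2)` with a real exponent; the weaker `3 ^
  -- n` avoids fractional powers.
  have h1 : (1 : ℝ) ≤ (3 ^ n) ^ 2 := one_le_pow₀ (one_le_pow₀ (by norm_num))
  calc (3 ^ n * ‖hX.toLp e 2 (by simp) p‖ ^ 2) ^ 2
      = 1 * ((3 ^ n) ^ 2 * ‖hX.toLp e 2 (by simp) p‖ ^ 4) := by ring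
    _ ≤ (3 ^ n) ^ 2 * ((3 ^ n) ^ 2 * ‖hX.toLp e 2 (by simp) p‖ ^ 4) := by gcongr
    _ = _ := by ring

/-- The polynomials of the `n`-th chaos, in any finite number of variables, as a subset of `L²`.
-/
def IsIsonormal.chaosSet (hX : IsIsonormal X P) (e : HilbertBasis ι ℝ H) (n : ℕ) :
    Set (Lp ℝ 2 P) :=
  {g | ∃ (S : Finset ι) (p : MvPolynomial ι ℝ), p ∈ chaos S n ∧ hX.toLp e 2 (by simp) p = g}

theorem IsIsonormal.exists_seq_of_mem_closure (hX : IsIsonormal X P) (e : HilbertBasis ι ℝ H)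
    {n : ℕ} {F : Lp ℝ 2 P} (hF : F ∈ closure (hX.chaosSet e n)) :
    ∃ (S : ℕ → Finset ι) (p : ℕ → MvPolynomial ι ℝ), (∀ j, p j ∈ chaos (S j) n) ∧
      Tendsto (fun j => hX.toLp e 2 (by simp) (p j)) atTop (𝓝 F) := by
  obtain ⟨g, hg, hlim⟩ := mem_closure_iff_seq_limit.1 hF
  choose S p hp hpg using hg
  exact ⟨S, p, hp, by simpa only [hpg] using hlim⟩

/-- Convergence in `L²` within a fixed chaos implies convergence in `L⁴`. -/
theorem IsIsonormal.exists_tendsto_toLp_four (hX : IsIsonormal X P) (e : HilbertBasis ι ℝ H)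
    {n : ℕ} {F : Lp ℝ 2 P} {S : ℕ → Finset ι} {p : ℕ → MvPolynomial ι ℝ}
    (hp : ∀ j, p j ∈ chaos (S j) n)
    (hlim : Tendsto (fun j => hX.toLp e 2 (by simp) (p j)) atTop (𝓝 F)) :
    ∃ G : Lp ℝ 4 P, G =ᵐ[P] F ∧
      Tendsto (fun j => hX.toLp e 4 (by simp) (p j)) atTop (𝓝 G) := by
  classical
  have hcau : CauchySeq fun j => hX.toLp e 4 (by simp) (p j) := by
    rw [Metric.cauchySeq_iff']
    intro ε hε
    obtain ⟨N, hN⟩ := Metric.cauchySeq_iff'.1 hlim.cauchySeq (ε / 3 ^ n) (by positivity)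
    refine ⟨N, fun j hj => ?_⟩
    have h1 := hN j hj
    rw [dist_eq_norm, ← map_sub] at h1 ⊢
    -- Differences of approximants stay in the chaos of order `n` over the union of their variables.
    refine (hX.norm_toLp_four_le e (S := S j ∪ S N) (sub_mem
      (chaos_mono Finset.subset_union_left n (hp j))
      (chaos_mono Finset.subset_union_right n (hp N)))).trans_lt ?_
    rwa [lt_div_iff₀ (by positivity), mul_comm] at h1
  obtain ⟨G, hG⟩ := cauchySeq_tendsto_of_complete hcau
  refine ⟨G, ?_, hG⟩
  -- The L² and L⁴ limits agree because both are limits in measure.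
  have h2 := tendstoInMeasure_of_tendsto_Lp hlim
  have h4 := tendstoInMeasure_of_tendsto_Lp hG
  refine tendstoInMeasure_ae_unique (h4.congr_left fun j => ?_) h2
  exact (hX.coeFn_toLp e (by simp) (p j)).trans (hX.coeFn_toLp e (by simp) (p j)).symm

theorem IsIsonormal.integral_eq_zero_of_mem_closure (hX : IsIsonormal X P)
    (e : HilbertBasis ι ℝ H) {n : ℕ} (hn : n ≠ 0) {F : Lp ℝ 2 P}
    (hF : F ∈ closure (hX.chaosSet e n)) : ∫ ω, F ω ∂P = 0 := by
  obtain ⟨S, p, hp, hlim⟩ := hX.exists_seq_of_mem_closure e hF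
  have h0 : inner ℝ F (hX.toLp e 2 (by simp) 1) = 0 := by
    refine tendsto_nhds_unique (hlim.inner tendsto_const_nhds) ?_
    simp only [hX.inner_toLp]
    exact tendsto_const_nhds.congr fun j =>
      ((hX.isGaussianExpectation e).map_mul_eq_zero hn (hp j) one_mem_chaos_zero).symm
  rw [← h0, L2.inner_def]
  refine integral_congr_ae ?_
  filter_upwards [hX.coeFn_toLp e (q := 2) (by simp) 1] with ω h1
  simp [h1]

/-- A normalized element of the closure of the `n`-th chaos with `n ≥ 2` has a finite fourth
moment, which exceeds `3`. -/
theorem IsIsonormal.three_lt_integral_pow_four (hX : IsIsonormal X P)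
    (e : HilbertBasis ι ℝ H) {n : ℕ} (hn : 2 ≤ n) {F : Lp ℝ 2 P}
    (hF : F ∈ closure (hX.chaosSet e n)) (h1 : ∫ ω, F ω ^ 2 ∂P = 1) :
    Integrable (fun ω => F ω ^ 4) P ∧ 3 < ∫ ω, F ω ^ 4 ∂P := by
  classical
  obtain ⟨S, p, hp, hlim⟩ := hX.exists_seq_of_mem_closure e hF
  obtain ⟨G, hGF, hG⟩ := hX.exists_tendsto_toLp_four e hp hlim
  have hE := hX.isGaussianExpectation e
  set E := hX.expectation e with hEdef
  have hGF4 : (fun ω => G ω ^ 4) =ᵐ[P] fun ω => F ω ^ 4 := by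
    filter_upwards [hGF] with ω h
    rw [h]
  have hlim4 : Tendsto (fun j => E (p j ^ 4)) atTop (𝓝 (∫ ω, F ω ^ 4 ∂P)) := by
    rw [← integral_congr_ae hGF4, ← norm_pow_four_eq_integral]
    exact (hG.norm.pow 4).congr fun j => hX.norm_toLp_four_pow e (p j)
  have hlim2 : Tendsto (fun j => E (p j ^ 2)) atTop (𝓝 1) := by
    rw [← h1, ← norm_sq_eq_integral]
    exact (hlim.norm.pow 2).congr fun j => hX.norm_toLp_two_sq e (p j)
  refine ⟨Integrable.congr ?_ hGF4, ?_⟩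
  · have := (Lp.memLp G).integrable_norm_pow (p := 4) (by norm_num)
    refine this.congr (ae_of_all _ fun ω => ?_)
    exact Even.pow_abs (by decide) _
  by_contra! hle
  have hderiv : ∀ l, ∀ k ∈ S l, Tendsto
      (fun j => E (MvPolynomial.pderiv k (p j) * MvPolynomial.pderiv k (p l))) atTop (𝓝 0) := by
    intro l k hk
    set b := E (MvPolynomial.pderiv k (p l) ^ 2) with hb
    set c : ℝ := 6 * (n - 1) with hc
    have hn' : (2 : ℝ) ≤ n := by exact_mod_cast hn
    have hcpos : 0 < c := by rw [hc]; linarith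
    -- The fourth power arises from squaring Cauchy–Schwarz, since the fourth moment excess controls
    -- the square of `E ((∂ₖ (p j)) ^ 2)`.
    have hbound : ∀ j, E (MvPolynomial.pderiv k (p j) * MvPolynomial.pderiv k (p l)) ^ 4 ≤
        b ^ 2 * (n * (E (p j ^ 4) - 3 * E (p j ^ 2) ^ 2) / c) := by
      intro j
      have h2 := hE.map_pow_four_ge (by omega)
        (chaos_mono (Finset.subset_union_left (s₂ := S l)) n (hp j))
        (Finset.mem_union_right (S j) hk)
      have h3 := hE.cauchy_schwarz (MvPolynomial.pderiv k (p j)) (MvPolynomial.pderiv k (p l))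
      rw [← hc, mul_comm, ← le_div_iff₀ hcpos] at h2
      calc _ = (E (MvPolynomial.pderiv k (p j) * MvPolynomial.pderiv k (p l)) ^ 2) ^ 2 := by ring
        _ ≤ (E (MvPolynomial.pderiv k (p j) ^ 2) * b) ^ 2 := by gcongr
        _ = b ^ 2 * E (MvPolynomial.pderiv k (p j) ^ 2) ^ 2 := by ring
        _ ≤ _ := by gcongr
    have hup := (((hlim4.sub ((hlim2.pow 2).const_mul 3)).const_mul (n : ℝ)).div_const c).const_mul
      (b ^ 2)
    have hneg : b ^ 2 * (n * (∫ ω, F ω ^ 4 ∂P - 3 * 1 ^ 2) / c) ≤ 0 := by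
      refine mul_nonpos_of_nonneg_of_nonpos (sq_nonneg b) (div_nonpos_of_nonpos_of_nonneg ?_
        hcpos.le)
      exact mul_nonpos_of_nonneg_of_nonpos (by positivity) (by linarith)
    have hpow : Tendsto (fun j => E (MvPolynomial.pderiv k (p j) *
        MvPolynomial.pderiv k (p l)) ^ 4) atTop (𝓝 0) := by
      -- The limit of the upper bounds is nonpositive by `hle` and nonnegative because it dominates
      -- fourth powers, so it is zero.
      have hle0 := le_antisymm hneg (ge_of_tendsto' hup fun j =>
        (by positivity : (0 : ℝ) ≤ _ ^ 4).trans (hbound j))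
      rw [hle0] at hup
      exact squeeze_zero (fun j => by positivity) hbound hup
    have habs := (hpow.rpow_const (p := (4 : ℝ)⁻¹) (Or.inr (by norm_num)))
    rw [Real.zero_rpow (by norm_num)] at habs
    refine tendsto_zero_iff_norm_tendsto_zero.2 (habs.congr fun j => ?_)
    rw [← Even.pow_abs (by decide : Even 4), ← Real.rpow_natCast, ← Real.rpow_mul (abs_nonneg _)]
    norm_num
  have horth : ∀ l, inner ℝ F (hX.toLp e 2 (by simp) (p l)) = 0 := by
    intro l
    have h2 : Tendsto (fun j => (n : ℝ) * E (p j * p l)) atTop (𝓝 0) := by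
      -- The sum runs over the fixed finite set `S l`, whatever the variables of `p j`, so termwise
      -- convergence suffices.
      simp only [hE.map_mul_of_mem_chaos _ (hp l)]
      simpa using tendsto_finsetSum (S l) (hderiv l)
    have h3 : Tendsto (fun j => (n : ℝ) * E (p j * p l)) atTop
        (𝓝 (n * inner ℝ F (hX.toLp e 2 (by simp) (p l)))) := by
      refine Tendsto.const_mul _ ((hlim.inner tendsto_const_nhds).congr fun j => ?_)
      exact hX.inner_toLp e (p j) (p l)
    have h4 := tendsto_nhds_unique h3 h2
    exact (mul_eq_zero.1 h4).resolve_left (by positivity)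
  have hFF : inner ℝ F F = (0 : ℝ) :=
    tendsto_nhds_unique (tendsto_const_nhds.inner hlim)
      (tendsto_const_nhds.congr fun l => (horth l).symm)
  rw [real_inner_self_eq_norm_sq, norm_sq_eq_integral, h1] at hFF
  exact one_ne_zero hFF

/-- Finite partial sums of the defining series are Hermite combinations of order `n`. -/
theorem multipleIntegral_mem_closure (hX : IsIsonormal X P) (e : HilbertBasis ι ℝ H) {n : ℕ}
    (f : symmTensorPower n H) : multipleIntegral hX e f ∈ closure (hX.chaosSet e n) := by
  classical
  rw [multipleIntegral]
  set v : (Fin n → ι) → Lp ℝ 2 P := fun i =>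
    (inner ℝ (f : HilbertTensorPower n H) (pureTensor fun j => e (i j)) : ℝ) •
      (hX.memLp_hermiteProd e i 2 (by simp)).toLp (hermiteProd X e i) with hv
  have hmem : ∀ A : Finset (Fin n → ι), ∑ i ∈ A, v i ∈ hX.chaosSet e n := by
    intro A
    refine ⟨A.biUnion fun i => Finset.univ.image i, ∑ i ∈ A,
      (inner ℝ (f : HilbertTensorPower n H) (pureTensor fun j => e (i j)) : ℝ) • hermitePoly i,
      sum_mem fun i hi => Submodule.smul_mem _ _ (hermitePoly_mem_chaos i ?_), ?_⟩
    · convert! Finset.subset_biUnion_of_mem (fun i : Fin n → ι => Finset.univ.image i) hi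
    · simp only [map_sum, map_smul, hv]
      refine Finset.sum_congr rfl fun i _ => congrArg _ ?_
      exact MemLp.toLp_congr (hX.memLp_aeval e (hermitePoly i) 2 (by simp)) _ (ae_of_all _ fun ω => aeval_hermitePoly X e i ω)
  -- Without summability `tsum` is 0, the empty partial sum, so convergence of the series is not
  -- needed here.
  by_cases hs : Summable v
  · exact mem_closure_of_tendsto hs.hasSum (Eventually.of_forall hmem)
  · rw [tsum_eq_zero_of_not_summable hs]
    exact subset_closure (by simpa using hmem ∅)

end ChaosClosure

theorem corollary2 {H Ω ι : Type*} [NormedAddCommGroup H] [InnerProductSpace ℝ H]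
    [CompleteSpace H] [TopologicalSpace.SeparableSpace H] [MeasurableSpace Ω]
    (P : Measure Ω) [IsProbabilityMeasure P] (X : H → Ω → ℝ) (hX : IsIsonormal X P)
    (e : HilbertBasis ι ℝ H) (n : ℕ) (hn : 2 ≤ n) (f : symmTensorPower n H)
    (hf : ∫ ω, (multipleIntegral hX e f ω) ^ 2 ∂P = 1) :
    ¬ HasGaussianLaw (multipleIntegral hX e f) P ∧
      Integrable (fun ω => (multipleIntegral hX e f ω) ^ 4) P ∧
      ∫ ω, (multipleIntegral hX e f ω) ^ 4 ∂P ≠ 3 := by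
  have hF := multipleIntegral_mem_closure hX e f
  obtain ⟨hint, hlt⟩ := hX.three_lt_integral_pow_four e hn hF hf
  refine ⟨fun hlaw => hlt.ne' ?_, hint, hlt.ne'⟩
  exact integral_pow_four_of_hasGaussianLaw hlaw
    (hX.integral_eq_zero_of_mem_closure e (by omega) hF) hf
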